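/- Let $p>2$ be an integer and let $r=(p-2)^{p-2}/(p-1)^{p-1}$. The complex initial value problem $s'=c^{p-1}$, $c'=-s^{p-1}$, $s(0)=0$, $c(0)=1$ has a holomorphic solution pair on the open disc $B_r(0)=\{z\in\mathbb C:|z|<r\}$. Let $(s,c)$ be any such pair. For $|w|\le 1$ put $$\tau(w)=\int_0^w\frac{d\zeta}{(1+\zeta^p)^{2/p}},$$ the integral being taken along the straight segment from $0$ to $w$ with the principal value of the power, and let $K_p=\tau(1)>0$. Let $\mathbb D$ be the open unit disc and let $\mathbb P$ be the open regular $p$-gon centred at $0$ that has $K_p$ as the midpoint of one of its edges, that is, the interior of the convex hull of the points $K_p\sec(\pi/p)\,e^{n\pi i/p}$ with $n$ odd. Then $B_r(0)\subseteq\mathbb P$, the function $c$ has no zero in $B_r(0)$, and the quotient $s/c$ on $B_r(0)$ extends to a function $t:\overline{\mathbb P}\to\overline{\mathbb D}$ that is a homeomorphism of $\overline{\mathbb P}$ onto $\overline{\mathbb D}$, restricts to a conformal (holomorphic, with nowhere vanishing derivative) bijection of $\mathbb P$ onto $\mathbb D$, and is the inverse of $\tau:\overline{\mathbb D}\to\overline{\mathbb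 P}$. -/

import Mathlib

open Complex Set Metric

noncomputable section

namespace HigherTrig

/-- `(s, c)` solves `s' = c ^ (p - 1)`, `c' = -s ^ (p - 1)`, `s 0 = 0`, `c 0 = 1`
holomorphically on the open set `U` (which is to contain `0`). -/
structure IsSolutionPair (p : ℕ) (U : Set ℂ) (s c : ℂ → ℂ) : Prop where
  deriv_s : ∀ z ∈ U, HasDerivAt s (c z ^ (p - 1)) z
  deriv_c : ∀ z ∈ U, HasDerivAt c (-(s z ^ (p - 1))) z
  s_zero : s 0 = 0
  c_zero : c 0 = 1

/-- The radius `r = (p - 2) ^ (p - 2) / (p - 1) ^ (p - 1)` of the disc about `0` on which the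
initial value problem is solved. -/
def solutionRadius (p : ℕ) : ℝ :=
  ((p : ℝ) - 2) ^ (p - 2) / ((p : ℝ) - 1) ^ (p - 1)

/-- The integrand `1 / (1 + ζ ^ p) ^ (2 / p)`, with the principal value of the power. -/
def scIntegrand (p : ℕ) (ζ : ℂ) : ℂ :=
  1 / (1 + ζ ^ p) ^ ((2 : ℂ) / (p : ℂ))

/-- The Schwarz-Christoffel map `τ w = ∫_0^w dζ / (1 + ζ ^ p) ^ (2 / p)`, the integral being taken
along the straight segment `ζ = x w`, `0 ≤ x ≤ 1`. -/
def tau (p : ℕ) (w : ℂ) : ℂ :=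
  ∫ x in (0 : ℝ)..1, scIntegrand p ((x : ℂ) * w) * w

/-- The inradius `K_p = ∫_0^1 dx / (1 + x ^ p) ^ (2 / p)`. -/
def inradius (p : ℕ) : ℝ :=
  ∫ x in (0 : ℝ)..1, 1 / (1 + x ^ p) ^ ((2 : ℝ) / (p : ℝ))

/-- The circumradius `L_p = K_p sec (π / p)`. -/
def circumradius (p : ℕ) : ℝ :=
  inradius p / Real.cos (Real.pi / p)

/-- The vertices `L_p β ^ n`, `n` odd, where `β = exp (π i / p)`. The midpoint of the two vertices
`L_p β` and `L_p β⁻¹` is `K_p`. -/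
def vertices (p : ℕ) : Set ℂ :=
  {z | ∃ k : ℕ, z = (circumradius p : ℂ) * exp (Real.pi * I / p) ^ (2 * k + 1)}

/-- The open regular `p`-gon centred at `0` that has `K_p` as the midpoint of one of its edges. -/
def openPolygon (p : ℕ) : Set ℂ :=
  interior (convexHull ℝ (vertices p))

/-- `f` restricts to a conformal bijection from the open set `U` onto `V`. -/
structure IsConformalBijection (f : ℂ → ℂ) (U V : Set ℂ) : Prop where
  holomorphic : DifferentiableOn ℂ f U
  deriv_ne_zero : ∀ z ∈ U, deriv f z ≠ 0
  bijOn : BijOn f U V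

/-- `f` restricts to a homeomorphism from `A` onto `B` (both with the subspace topology). -/
def RestrictsToHomeomorph (f : ℂ → ℂ) (A B : Set ℂ) : Prop :=
  ∃ e : A ≃ₜ B, ∀ z : A, (e z : ℂ) = f z

end HigherTrig

end

/-! For `|w| < 1` the number `1 + w ^ p` lies in the right half-plane and `2 / p < 1`, so `τ'` has
positive real part. Hence `τ` is injective by the Noshiro–Warschawski argument, which reaches the
closed disc because the singularities of `τ'` on the circle are integrable (`continuousOn_tau`,
`injOn_tau`). On the arc `|θ| < π / p` the velocity of `τ (exp (iθ))` is a positive multiple of `i`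
(`scIntegrand_exp`, `hasDerivAt_tau_exp`), so the arc climbs the line `re = K_p`; rotation by `p`-th
roots of unity puts the rest of the circle on the other edges. The image of the open disc is open
and that of the closed disc compact, so maximising a linear functional confines the image to the
polygon, and connectedness makes it fill the interior (`tau_image_ball`). The inverse `t` satisfies
`t' = (1 + t ^ p) ^ (2 / p)`. Therefore `c = (1 + t ^ p) ^ (-1 / p)` and `s = t c` solve the system
on the whole polygon (`isSolutionPair_tauInv`). Since `r ≤ 1/2 ≤ K_p`, the disc lies in the polygon,
so existence follows by restriction, and uniqueness along rays identifies every other pair with this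
one. -/

namespace HigherTrig

open MeasureTheory Filter Topology

/-! ### Primitives along segments and the Schwarz–Christoffel integrand -/

/-- On a domain containing the segment from `0` to `w`, the integral of a holomorphic function
along the segment from `0` is a primitive near `w`. -/
theorem hasDerivAt_integral_segment {f : ℂ → ℂ} {U : Set ℂ} (hU : IsOpen U)
    (hf : DifferentiableOn ℂ f U) {w : ℂ} (hw : segment ℝ 0 w ⊆ U) :
    HasDerivAt (fun v : ℂ => ∫ x in (0 : ℝ)..1, f ((x : ℂ) * v) * v) (f w) w := by
  have hcpt : IsCompact (segment ℝ (0 : ℂ) w) := by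
    rw [segment_eq_image_lineMap]
    exact isCompact_Icc.image (AffineMap.lineMap_continuous)
  -- A thin neighbourhood of the segment is convex and still inside `U`, so no topology of `U`
  -- enters.
  obtain ⟨δ, hδ, hV⟩ := hcpt.exists_thickening_subset_open hU hw
  have hVc : Convex ℝ (thickening δ (segment ℝ (0 : ℂ) w)) := (convex_segment 0 w).thickening δ
  have hVo : IsOpen (thickening δ (segment ℝ (0 : ℂ) w)) := isOpen_thickening
  have hsub := self_subset_thickening hδ (segment ℝ (0 : ℂ) w)
  generalize thickening δ (segment ℝ (0 : ℂ) w) = V at *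
  -- Complex linearity of the derivative of `f` makes the form `f dz` closed; the Poincaré lemma on
  -- `V` then gives a primitive.
  have hω : ∀ z ∈ V, HasFDerivAt (fun z => f z • (1 : ℂ →L[ℂ] ℂ))
      (((ContinuousLinearMap.toSpanSingleton ℂ (deriv f z)).restrictScalars ℝ).smulRight
        (1 : ℂ →L[ℂ] ℂ)) z := fun z hz =>
    ((hf.differentiableAt (hU.mem_nhds (hV hz))).hasDerivAt.hasFDerivAt.restrictScalars ℝ).smul_const
      (1 : ℂ →L[ℂ] ℂ)
  obtain ⟨F, hF⟩ := hVc.exists_forall_hasFDerivAt_of_fderiv_symmetric hVo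
    (ω := fun z => f z • (1 : ℂ →L[ℂ] ℂ))
    (fun z hz => (hω z hz).differentiableAt.differentiableWithinAt) (by
      intro a ha x y
      rw [(hω a ha).fderiv]
      simp only [ContinuousLinearMap.smulRight_apply, ContinuousLinearMap.coe_restrictScalars',
        ContinuousLinearMap.toSpanSingleton_apply, smul_eq_mul, _root_.smul_apply,
        one_apply_eq_self]
      ring)
  have hF' : ∀ z ∈ V, HasDerivAt F (f z) z := fun z hz => by
    simpa using (hF z hz).hasDerivAt
  have h0 : (0 : ℂ) ∈ V := hsub (left_mem_segment ℝ 0 w)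
  have key : ∀ v ∈ V, ∫ x in (0 : ℝ)..1, f ((x : ℂ) * v) * v = F v - F 0 := by
    intro v hv
    have hm : ∀ x ∈ uIcc (0 : ℝ) 1, (x : ℂ) * v ∈ V := by
      intro x hx
      rw [uIcc_of_le zero_le_one] at hx
      have := hVc h0 hv (sub_nonneg.2 hx.2) hx.1 (by ring)
      simpa using this
    have hd : ∀ x ∈ uIcc (0 : ℝ) 1,
        HasDerivAt (fun y : ℝ => F ((y : ℂ) * v)) (f ((x : ℂ) * v) * v) x := by
      intro x hx
      have h1 : HasDerivAt (fun y : ℂ => y * v) v (x : ℂ) := by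
        simpa using (hasDerivAt_id (x : ℂ)).mul_const v
      exact (HasDerivAt.comp (x : ℂ) (hF' _ (hm x hx)) h1).comp_ofReal
    rw [intervalIntegral.integral_eq_sub_of_hasDerivAt hd]
    · simp
    · refine ContinuousOn.intervalIntegrable fun x hx => ?_
      have h1 : ContinuousAt f ((x : ℂ) * v) :=
        (hf.differentiableAt (hU.mem_nhds (hV (hm x hx)))).continuousAt
      have h2 : ContinuousAt (fun y : ℝ => (y : ℂ) * v) x := by fun_prop
      exact ((ContinuousAt.comp (f := fun y : ℝ => (y : ℂ) * v) h1 h2).mul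
        continuousAt_const).continuousWithinAt
  have hwV : w ∈ V := hsub (right_mem_segment ℝ 0 w)
  refine ((hF' w hwV).sub_const (F 0)).congr_of_eventuallyEq ?_
  filter_upwards [hVo.mem_nhds hwV] with v hv using key v hv

theorem two_div_natCast (p : ℕ) : (2 : ℂ) / (p : ℂ) = ((2 / p : ℝ) : ℂ) := by push_cast; rfl

theorem isOpen_integrandDomain (p : ℕ) : IsOpen {w : ℂ | 1 + w ^ p ∈ slitPlane} :=
  isOpen_slitPlane.preimage (by fun_prop)

theorem differentiableAt_scIntegrand {p : ℕ} {w : ℂ} (hw : 1 + w ^ p ∈ slitPlane) :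
    DifferentiableAt ℂ (scIntegrand p) w := by
  unfold scIntegrand
  refine DifferentiableAt.div (by fun_prop) (DifferentiableAt.cpow_const (by fun_prop) hw) ?_
  simp [cpow_eq_zero_iff, slitPlane_ne_zero hw]

theorem scIntegrand_ne_zero {p : ℕ} {w : ℂ} (hw : 1 + w ^ p ∈ slitPlane) :
    scIntegrand p w ≠ 0 := by
  simp [scIntegrand, cpow_eq_zero_iff, slitPlane_ne_zero hw]

/-- The slit plane is star-shaped about `1`, and `1 + (x w) ^ p` divides the segment from `1` to `1
+ w ^ p` in the ratio given by `x ^ p`. -/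
theorem ofReal_mul_mem_integrandDomain {p : ℕ} {w : ℂ} (hw : 1 + w ^ p ∈ slitPlane)
    {x : ℝ} (hx : x ∈ Icc (0 : ℝ) 1) : 1 + ((x : ℂ) * w) ^ p ∈ slitPlane := by
  have h := starConvex_one_slitPlane hw (sub_nonneg.2 (pow_le_one₀ (n := p) hx.1 hx.2))
    (pow_nonneg hx.1 p) (by ring)
  convert h using 1
  simp only [real_smul]
  push_cast
  ring

theorem hasDerivAt_tau {p : ℕ} {w : ℂ} (hw : 1 + w ^ p ∈ slitPlane) :
    HasDerivAt (tau p) (scIntegrand p w) w := by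
  refine hasDerivAt_integral_segment (isOpen_integrandDomain p)
    (fun z hz => (differentiableAt_scIntegrand hz).differentiableWithinAt) ?_
  rintro z ⟨a, b, ha, hb, hab, rfl⟩
  have := ofReal_mul_mem_integrandDomain hw (x := b) ⟨hb, by linarith⟩
  simpa using this

theorem one_add_pow_mem_slitPlane {p : ℕ} (hp : p ≠ 0) {w : ℂ} (hw : w ∈ ball (0 : ℂ) 1) :
    1 + w ^ p ∈ slitPlane := by
  refine mem_slitPlane_of_norm_lt_one ?_
  rw [norm_pow]
  exact pow_lt_one₀ (norm_nonneg _) (by simpa using hw) hp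

/-- The exponent `2 / p < 1` shrinks the argument, which already lies in `(-π/2, π/2)`. -/
theorem cpow_two_div_re_pos {p : ℕ} (hp : 2 < p) {z : ℂ} (hz : 0 < z.re) :
    0 < (z ^ ((2 : ℂ) / (p : ℂ))).re := by
  have hz0 : z ≠ 0 := by rintro rfl; simp at hz
  have hp' : (2 : ℝ) < p := by exact_mod_cast hp
  rw [two_div_natCast, cpow_def_of_ne_zero hz0, exp_re]
  refine mul_pos (Real.exp_pos _) (Real.cos_pos_of_mem_Ioo ?_)
  rw [im_mul_ofReal, log_im, mem_Ioo, ← abs_lt, abs_mul, abs_of_pos (by positivity : 0 < 2 / (p : ℝ))]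
  have h1 := abs_arg_lt_pi_div_two_iff.2 (Or.inl hz)
  have h2 : 2 / (p : ℝ) ≤ 1 := (div_le_one (by linarith)).2 hp'.le
  nlinarith [abs_nonneg z.arg]

theorem scIntegrand_re_pos {p : ℕ} (hp : 2 < p) {w : ℂ} (hw : w ∈ ball (0 : ℂ) 1) :
    0 < (scIntegrand p w).re := by
  have hn : ‖w ^ p‖ < 1 := by
    rw [norm_pow]
    exact pow_lt_one₀ (norm_nonneg _) (by simpa using hw) (by omega)
  have h1 : 0 < (1 + w ^ p).re := by
    have := abs_re_le_norm (w ^ p)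
    have := neg_abs_le (w ^ p).re
    simp only [add_re, one_re]
    linarith
  have h2 := cpow_two_div_re_pos hp h1
  rw [scIntegrand, one_div, inv_re]
  refine div_pos h2 (normSq_pos.2 fun h => ?_)
  simp [h] at h2

/-! ### Continuity and injectivity on the closed disc -/

/-- Dominated convergence: `|1 + (x w) ^ p| ≥ 1 - x` uniformly in `|w| ≤ 1`, and `(1 - x) ^ (-2 /
p)` is integrable because `2 / p < 1`. -/
theorem continuousOn_tau {p : ℕ} (hp : 2 < p) : ContinuousOn (tau p) (closedBall 0 1) := by
  intro w₀ hw₀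
  have hp' : (2 : ℝ) < p := by exact_mod_cast hp
  have hball : ∀ w ∈ closedBall (0 : ℂ) 1, ∀ x ∈ Ico (0 : ℝ) 1, (x : ℂ) * w ∈ ball (0 : ℂ) 1 := by
    intro w hw x hx
    simp only [mem_closedBall_zero_iff, mem_ball_zero_iff, norm_mul, norm_real] at hw ⊢
    rw [Real.norm_of_nonneg hx.1]
    nlinarith [hx.1, hx.2, norm_nonneg w]
  have hae : ∀ᵐ x : ℝ, x ≠ 1 := by simp [ae_iff]
  refine intervalIntegral.continuousWithinAt_of_dominated_interval
    (bound := fun x : ℝ => (1 - x) ^ (-(2 / p) : ℝ)) ?_ ?_ ?_ ?_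
  · filter_upwards [self_mem_nhdsWithin] with w hw
    rw [uIoc_of_le zero_le_one, ← restrict_Ioo_eq_restrict_Ioc]
    refine ContinuousOn.aestronglyMeasurable (fun x hx => ?_) measurableSet_Ioo
    have h1 : ContinuousAt (scIntegrand p) ((x : ℂ) * w) :=
      (differentiableAt_scIntegrand (one_add_pow_mem_slitPlane (by omega)
        (hball w hw x ⟨hx.1.le, hx.2⟩))).continuousAt
    have h2 : ContinuousAt (fun y : ℝ => (y : ℂ) * w) x := by fun_prop
    exact ((ContinuousAt.comp (f := fun y : ℝ => (y : ℂ) * w) h1 h2).mul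
        continuousAt_const).continuousWithinAt
  · filter_upwards [self_mem_nhdsWithin] with w hw
    filter_upwards [hae] with x hx1 hx
    rw [uIoc_of_le zero_le_one] at hx
    have hx2 : x < 1 := lt_of_le_of_ne hx.2 hx1
    have hw1 : ‖w‖ ≤ 1 := by simpa using hw
    rw [norm_mul, scIntegrand, two_div_natCast, norm_div, norm_one, norm_cpow_real]
    have h1 : 1 - x ≤ ‖1 + ((x : ℂ) * w) ^ p‖ := by
      have h2 : ‖((x : ℂ) * w) ^ p‖ ≤ x := by
        rw [norm_pow, norm_mul, norm_real, Real.norm_of_nonneg hx.1.le]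
        calc (x * ‖w‖) ^ p ≤ x ^ p := by
              have := hx.1
              gcongr
              exact mul_le_of_le_one_right hx.1.le hw1
          _ ≤ x := pow_le_of_le_one hx.1.le hx.2 (by omega)
      have h4 : (1 : ℂ) + ((x : ℂ) * w) ^ p = 1 - -(((x : ℂ) * w) ^ p) := by ring
      rw [h4]
      have h3 := norm_sub_norm_le (1 : ℂ) (-(((x : ℂ) * w) ^ p))
      rw [norm_one, norm_neg] at h3
      linarith
    have h0 : 0 < 1 - x := by linarith
    rw [Real.rpow_neg h0.le, one_div]
    calc (‖1 + ((x : ℂ) * w) ^ p‖ ^ (2 / p : ℝ))⁻¹ * ‖w‖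
        ≤ (‖1 + ((x : ℂ) * w) ^ p‖ ^ (2 / p : ℝ))⁻¹ * 1 := by gcongr
      _ ≤ ((1 - x) ^ (2 / p : ℝ))⁻¹ := by
        rw [mul_one]
        gcongr
  · have h : IntervalIntegrable (fun x : ℝ => x ^ (-(2 / p) : ℝ)) volume 0 1 := by
      refine intervalIntegral.intervalIntegrable_rpow' ?_
      rw [neg_lt_neg_iff, div_lt_one (by linarith)]
      exact hp'
    simpa using (h.comp_sub_left 1).symm
  · filter_upwards [hae] with x hx1 hx
    rw [uIoc_of_le zero_le_one] at hx
    have hx2 : x < 1 := lt_of_le_of_ne hx.2 hx1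
    have h1 : ContinuousAt (scIntegrand p) ((x : ℂ) * w₀) :=
      (differentiableAt_scIntegrand (one_add_pow_mem_slitPlane (by omega)
        (hball w₀ hw₀ x ⟨hx.1.le, hx2⟩))).continuousAt
    have h2 : ContinuousAt (fun w : ℂ => (x : ℂ) * w) w₀ := by fun_prop
    exact ((ContinuousAt.comp (f := fun w : ℂ => (x : ℂ) * w) h1 h2).mul
        continuousAt_id).continuousWithinAt

/-- Along the chord from `a` to `b` the component of `τ` in the direction `b - a` has derivative `|b
- a| ^ 2 * re τ' > 0`. Strict convexity keeps the inner points of the chord in the open disc, so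
continuity suffices at the ends. -/
theorem injOn_tau {p : ℕ} (hp : 2 < p) : InjOn (tau p) (closedBall 0 1) := by
  intro a ha b hb hab
  by_contra hne
  have hd0 : b - a ≠ 0 := sub_ne_zero.2 (Ne.symm hne)
  let γ : ℝ → ℂ := fun t => a + (t : ℂ) * (b - a)
  have hγ : Continuous γ := by fun_prop
  have hmem : ∀ t ∈ Icc (0 : ℝ) 1, γ t ∈ closedBall (0 : ℂ) 1 := by
    intro t ht
    have := (convex_closedBall (0 : ℂ) 1) ha hb (sub_nonneg.2 ht.2) ht.1 (by ring)
    convert this using 1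
    simp only [γ, real_smul]
    push_cast
    ring
  have hmem' : ∀ t ∈ Ioo (0 : ℝ) 1, γ t ∈ ball (0 : ℂ) 1 := by
    intro t ht
    have := (strictConvex_closedBall ℝ (0 : ℂ) 1) ha hb hne (sub_pos.2 ht.2) ht.1 (by ring)
    rw [interior_closedBall _ one_ne_zero] at this
    convert this using 1
    simp only [γ, real_smul]
    push_cast
    ring
  let g : ℝ → ℝ := fun t => (tau p (γ t) * (starRingEnd ℂ) (b - a)).re
  have hg : ContinuousOn g (Icc 0 1) := by
    refine continuous_re.comp_continuousOn (ContinuousOn.mul ?_ continuousOn_const)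
    exact (continuousOn_tau hp).comp hγ.continuousOn hmem
  have hg' : ∀ t ∈ interior (Icc (0 : ℝ) 1), 0 < deriv g t := by
    intro t ht
    rw [interior_Icc] at ht
    have h1 := hasDerivAt_tau (one_add_pow_mem_slitPlane (p := p) (by omega) (hmem' t ht))
    have h2 : HasDerivAt (fun z : ℂ => a + z * (b - a)) (b - a) (t : ℂ) := by
      simpa using ((hasDerivAt_id (t : ℂ)).mul_const (b - a)).const_add a
    have h3 := ((HasDerivAt.comp (t : ℂ) h1 h2).mul_const ((starRingEnd ℂ) (b - a))).real_of_complex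
    have h4 : deriv g t = normSq (b - a) * (scIntegrand p (γ t)).re := by
      refine h3.deriv.trans ?_
      rw [mul_assoc, mul_conj, mul_comm, re_ofReal_mul]
    rw [h4]
    exact mul_pos (normSq_pos.2 hd0) (scIntegrand_re_pos hp (hmem' t ht))
  have hlt := strictMonoOn_of_deriv_pos (convex_Icc 0 1) hg hg' (left_mem_Icc.2 zero_le_one)
    (right_mem_Icc.2 zero_le_one) zero_lt_one
  simp [g, γ, hab] at hlt

/-! ### Rotational symmetry, the inradius and the solution radius -/

theorem tau_zero (p : ℕ) : tau p 0 = 0 := by simp [tau]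

theorem tau_mul_of_pow_eq_one {p : ℕ} {ω : ℂ} (hω : ω ^ p = 1) (w : ℂ) :
    tau p (ω * w) = ω * tau p w := by
  unfold tau
  rw [← intervalIntegral.integral_const_mul]
  refine intervalIntegral.integral_congr fun x _ => ?_
  have : ((x : ℂ) * (ω * w)) ^ p = ((x : ℂ) * w) ^ p := by
    rw [mul_left_comm, mul_pow ω, hω, one_mul]
  simp only [scIntegrand, this]
  ring

theorem tau_one (p : ℕ) : tau p 1 = inradius p := by
  unfold tau inradius
  rw [← intervalIntegral.integral_ofReal]
  refine intervalIntegral.integral_congr fun x hx => ?_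
  rw [uIcc_of_le zero_le_one] at hx
  have h : 0 ≤ 1 + x ^ p := add_nonneg zero_le_one (pow_nonneg hx.1 p)
  simp only [scIntegrand, mul_one, two_div_natCast]
  push_cast
  rw [ofReal_cpow h]
  push_cast
  rfl

theorem one_half_le_inradius {p : ℕ} (hp : 2 < p) : 1 / 2 ≤ inradius p := by
  have hp' : (2 : ℝ) < p := by exact_mod_cast hp
  have hpos : ∀ x ∈ Icc (0 : ℝ) 1, 1 ≤ 1 + x ^ p := fun x hx => by
    linarith [pow_nonneg hx.1 p]
  have h : ∫ x in (0 : ℝ)..1, (1 / 2 : ℝ) ≤ inradius p := by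
    refine intervalIntegral.integral_mono_on zero_le_one (by simp) ?_ fun x hx => ?_
    · refine ContinuousOn.intervalIntegrable ?_
      rw [uIcc_of_le zero_le_one]
      refine ContinuousOn.div continuousOn_const (ContinuousOn.rpow_const (by fun_prop) ?_) ?_
      · intro x hx
        exact Or.inl (by linarith [hpos x hx])
      · intro x hx
        exact (Real.rpow_pos_of_pos (by linarith [hpos x hx]) _).ne'
    · have h1 := hpos x hx
      have h2 : 1 + x ^ p ≤ 2 := by linarith [pow_le_one₀ (n := p) hx.1 hx.2]
      refine one_div_le_one_div_of_le (Real.rpow_pos_of_pos (by linarith) _) ?_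
      calc (1 + x ^ p) ^ (2 / p : ℝ) ≤ (1 + x ^ p) ^ (1 : ℝ) :=
            Real.rpow_le_rpow_of_exponent_le h1 ((div_le_one (by linarith)).2 hp'.le)
        _ ≤ 2 := by rwa [Real.rpow_one]
  simpa using h

/-- Replacing `(p - 2) ^ (p - 2)` by `(p - 1) ^ (p - 2)` bounds the radius by `1 / (p - 1)`. -/
theorem solutionRadius_le_one_half {p : ℕ} (hp : 2 < p) : solutionRadius p ≤ 1 / 2 := by
  obtain ⟨n, rfl⟩ : ∃ n, p = n + 3 := ⟨p - 3, by omega⟩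
  have h1 : n + 3 - 2 = n + 1 := by omega
  have h2 : n + 3 - 1 = n + 1 + 1 := by omega
  unfold solutionRadius
  rw [h1, h2]
  push_cast
  have hn : (0 : ℝ) ≤ n := n.cast_nonneg
  have h3 : ((n : ℝ) + 3 - 2) ^ (n + 1) ≤ ((n : ℝ) + 3 - 1) ^ (n + 1) := by
    gcongr <;> linarith
  rw [div_le_iff₀ (pow_pos (by linarith) _), pow_succ _ (n + 1)]
  have h4 : 0 ≤ ((n : ℝ) + 3 - 1) ^ (n + 1) := pow_nonneg (by linarith) _
  nlinarith

theorem solutionRadius_pos {p : ℕ} (hp : 2 < p) : 0 < solutionRadius p := by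
  have hp' : (2 : ℝ) < p := by exact_mod_cast hp
  exact div_pos (pow_pos (by linarith) _) (pow_pos (by linarith) _)

/-- The primitive `2p`-th root of unity `exp (π i / p)`. -/
noncomputable def halfRoot (p : ℕ) : ℂ := exp (Real.pi * I / p)

theorem halfRoot_eq (p : ℕ) : halfRoot p = exp ((Real.pi / p : ℝ) * I) := by
  unfold halfRoot
  congr 1
  push_cast
  ring

theorem halfRoot_pow {p : ℕ} (hp : p ≠ 0) : halfRoot p ^ p = -1 := by
  have hp' : (p : ℂ) ≠ 0 := by exact_mod_cast hp
  rw [halfRoot, ← exp_nat_mul, mul_div_cancel₀ _ hp', exp_pi_mul_I]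

theorem halfRoot_sq_pow {p : ℕ} (hp : p ≠ 0) : (halfRoot p ^ 2) ^ p = 1 := by
  rw [← pow_mul, mul_comm, pow_mul, halfRoot_pow hp]
  norm_num

theorem cos_pi_div_pos {p : ℕ} (hp : 2 < p) : 0 < Real.cos (Real.pi / p) := by
  have hp' : (2 : ℝ) < p := by exact_mod_cast hp
  refine Real.cos_pos_of_mem_Ioo ⟨?_, ?_⟩
  · have : 0 < Real.pi / p := by positivity
    linarith [Real.pi_pos]
  · exact div_lt_div_of_pos_left Real.pi_pos (by norm_num) hp'

theorem inradius_pos {p : ℕ} (hp : 2 < p) : 0 < inradius p :=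
  lt_of_lt_of_le (by norm_num) (one_half_le_inradius hp)

theorem circumradius_pos {p : ℕ} (hp : 2 < p) : 0 < circumradius p :=
  div_pos (inradius_pos hp) (cos_pi_div_pos hp)

/-! ### Arcs of the circle are mapped into edges of the polygon -/

section Arc

variable {p : ℕ} {θ : ℝ}

theorem one_add_exp_pow (p : ℕ) (θ : ℝ) :
    1 + exp (θ * I) ^ p = ((2 * Real.cos (p * θ / 2) : ℝ) : ℂ) * exp ((p * θ / 2 : ℝ) * I) := by
  rw [← exp_nat_mul]
  push_cast
  rw [two_cos, add_mul, ← exp_add, ← exp_add, add_comm]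
  congr 1
  · congr 1
    ring
  · rw [← exp_zero]
    congr 1
    ring

theorem half_angle_mem (hp : 2 < p) (hθ : θ ∈ Ioo (-(Real.pi / p)) (Real.pi / p)) :
    p * θ / 2 ∈ Ioo (-(Real.pi / 2)) (Real.pi / 2) := by
  have hp' : (2 : ℝ) < p := by exact_mod_cast hp
  have hp0 : (0 : ℝ) < p := by linarith
  have h1 : p * (Real.pi / p) = Real.pi := mul_div_cancel₀ _ hp0.ne'
  constructor
  · have := mul_lt_mul_of_pos_left hθ.1 hp0
    linarith
  · have := mul_lt_mul_of_pos_left hθ.2 hp0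
    linarith

theorem one_add_exp_pow_mem_slitPlane (hp : 2 < p)
    (hθ : θ ∈ Ioo (-(Real.pi / p)) (Real.pi / p)) : 1 + exp (θ * I) ^ p ∈ slitPlane := by
  have hcos := Real.cos_pos_of_mem_Ioo (half_angle_mem hp hθ)
  rw [one_add_exp_pow]
  refine Or.inl ?_
  rw [re_ofReal_mul, exp_ofReal_mul_I_re]
  positivity

/-- By the half-angle formula `1 + exp (iθ) ^ p` has principal argument `p θ / 2`; the power `2 / p`
turns it into exactly `θ`, which the factor `exp (iθ)` cancels. This is why edges are straight. -/
theorem scIntegrand_exp (hp : 2 < p) (hθ : θ ∈ Ioo (-(Real.pi / p)) (Real.pi / p)) :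
    scIntegrand p (exp (θ * I)) * exp (θ * I) =
      (((2 * Real.cos (p * θ / 2)) ^ (2 / p : ℝ))⁻¹ : ℝ) := by
  have hα := half_angle_mem hp hθ
  have hcos : 0 < 2 * Real.cos (p * θ / 2) := by
    have := Real.cos_pos_of_mem_Ioo hα
    positivity
  have hp0 : (p : ℂ) ≠ 0 := by
    have : p ≠ 0 := by omega
    exact_mod_cast this
  have hlog : log (exp ((p * θ / 2 : ℝ) * I)) = (p * θ / 2 : ℝ) * I := by
    refine log_exp ?_ ?_
    · simp only [im_ofReal_mul, I_im, mul_one]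
      linarith [hα.1, Real.pi_pos]
    · simp only [im_ofReal_mul, I_im, mul_one]
      linarith [hα.2, Real.pi_pos]
  have key : (1 + exp (θ * I) ^ p) ^ ((2 : ℂ) / p) =
      (((2 * Real.cos (p * θ / 2)) ^ (2 / p : ℝ) : ℝ) : ℂ) * exp (θ * I) := by
    rw [cpow_def_of_ne_zero (slitPlane_ne_zero (one_add_exp_pow_mem_slitPlane hp hθ)),
      one_add_exp_pow, log_ofReal_mul hcos (exp_ne_zero _), hlog, add_mul, exp_add,
      Real.rpow_def_of_pos hcos, ofReal_exp]
    congr 2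
    · push_cast
      rfl
    · push_cast
      field_simp
  rw [scIntegrand, key, ofReal_inv, one_div, mul_inv, mul_assoc, inv_mul_cancel₀ (exp_ne_zero _),
    mul_one]

theorem hasDerivAt_tau_exp (hp : 2 < p) (hθ : θ ∈ Ioo (-(Real.pi / p)) (Real.pi / p)) :
    HasDerivAt (fun t : ℝ => tau p (exp (t * I)))
      ((((2 * Real.cos (p * θ / 2)) ^ (2 / p : ℝ))⁻¹ : ℝ) * I) θ := by
  have h1 : HasDerivAt (fun t : ℂ => exp (t * I)) (exp (θ * I) * I) (θ : ℂ) := by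
    simpa using ((hasDerivAt_id (θ : ℂ)).mul_const I).cexp
  have h2 := (HasDerivAt.comp (θ : ℂ)
    (hasDerivAt_tau (one_add_exp_pow_mem_slitPlane hp hθ)) h1).comp_ofReal
  rw [← mul_assoc, scIntegrand_exp hp hθ] at h2
  exact h2

theorem continuous_tau_exp (hp : 2 < p) : Continuous (fun t : ℝ => tau p (exp (t * I))) := by
  refine (continuousOn_tau hp).comp_continuous (by fun_prop) fun t => ?_
  simp [norm_exp_ofReal_mul_I]

/-- The velocity on the open arc is purely imaginary, and `θ = 0` gives the value `τ 1 = K_p`. The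
end points, where `τ'` is singular, are reached by continuity. -/
theorem tau_exp_re (hp : 2 < p) (hθ : θ ∈ Icc (-(Real.pi / p)) (Real.pi / p)) :
    (tau p (exp (θ * I))).re = inradius p := by
  have hc := continuous_re.comp (continuous_tau_exp hp)
  have hpi : 0 < Real.pi / p := div_pos Real.pi_pos (by exact_mod_cast (by omega : 0 < p))
  have hd : ∀ t ∈ Ioo (-(Real.pi / p)) (Real.pi / p),
      HasDerivAt (fun t : ℝ => (tau p (exp (t * I))).re) 0 t := by
    intro t ht
    have := reCLM.hasFDerivAt.comp_hasDerivAt t (hasDerivAt_tau_exp hp ht)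
    simp only [reCLM_apply, re_ofReal_mul, I_re, mul_zero] at this
    exact this
  have h0 : (0 : ℝ) ∈ Ioo (-(Real.pi / p)) (Real.pi / p) := ⟨by linarith, hpi⟩
  have heq : EqOn (fun t : ℝ => (tau p (exp (t * I))).re) (fun _ => inradius p)
      (Ioo (-(Real.pi / p)) (Real.pi / p)) := by
    intro t ht
    have := (convex_Ioo (-(Real.pi / p)) (Real.pi / p)).is_const_of_fderivWithin_eq_zero (𝕜 := ℝ)
      (f := fun t : ℝ => (tau p (exp (t * I))).re)
      (fun t ht => (hd t ht).differentiableAt.differentiableWithinAt)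
      (fun t ht => by
        rw [fderivWithin_of_isOpen isOpen_Ioo ht]
        ext
        simpa using (hd t ht).deriv) ht h0
    simpa [tau_one] using this
  have := heq.closure hc continuous_const
  rw [closure_Ioo (by linarith)] at this
  exact this hθ

theorem monotoneOn_tau_exp_im (hp : 2 < p) :
    MonotoneOn (fun t : ℝ => (tau p (exp (t * I))).im) (Icc (-(Real.pi / p)) (Real.pi / p)) := by
  have hd : ∀ t ∈ Ioo (-(Real.pi / p)) (Real.pi / p),
      HasDerivAt (fun t : ℝ => (tau p (exp (t * I))).im)
        ((2 * Real.cos (p * t / 2)) ^ (2 / p : ℝ))⁻¹ t := by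
    intro t ht
    have := imCLM.hasFDerivAt.comp_hasDerivAt t (hasDerivAt_tau_exp hp ht)
    simp only [imCLM_apply, im_ofReal_mul, I_im, mul_one] at this
    exact this
  refine monotoneOn_of_deriv_nonneg (convex_Icc _ _)
    (continuous_im.comp (continuous_tau_exp hp)).continuousOn ?_ ?_
  · rw [interior_Icc]
    exact fun t ht => (hd t ht).differentiableAt.differentiableWithinAt
  · rw [interior_Icc]
    intro t ht
    rw [(hd t ht).deriv]
    have := Real.cos_pos_of_mem_Ioo (half_angle_mem hp ht)
    positivity

theorem mem_segment_of_re_eq {a b z : ℂ} (ha : a.re = z.re) (hb : b.re = z.re)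
    (h1 : a.im ≤ z.im) (h2 : z.im ≤ b.im) : z ∈ segment ℝ a b := by
  have : z.im ∈ segment ℝ a.im b.im := by
    rw [segment_eq_Icc (h1.trans h2)]
    exact ⟨h1, h2⟩
  obtain ⟨s, t, hs, ht, hst, h⟩ := this
  refine ⟨s, t, hs, ht, hst, Complex.ext ?_ ?_⟩
  · simp [ha, hb, ← add_mul, hst]
  · simpa using h

/-- On the ray through `halfRoot p` the integrand is real, so the value stays on that ray; its real
part `K_p` then fixes its length without evaluating the integral. -/
theorem tau_halfRoot (hp : 2 < p) : tau p (halfRoot p) = circumradius p * halfRoot p := by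
  obtain ⟨L, hL⟩ : ∃ L : ℝ, tau p (halfRoot p) = L * halfRoot p := by
    refine ⟨∫ x in (0 : ℝ)..1, 1 / (1 - x ^ p) ^ (2 / p : ℝ), ?_⟩
    unfold tau
    rw [intervalIntegral.integral_mul_const, ← intervalIntegral.integral_ofReal]
    congr 1
    refine intervalIntegral.integral_congr fun x hx => ?_
    rw [uIcc_of_le zero_le_one] at hx
    have h : 0 ≤ 1 - x ^ p := sub_nonneg.2 (pow_le_one₀ hx.1 hx.2)
    simp only [scIntegrand, two_div_natCast, mul_pow, halfRoot_pow (show p ≠ 0 by omega)]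
    push_cast
    rw [ofReal_cpow h]
    push_cast
    rw [mul_neg_one, ← sub_eq_add_neg]
  have hpi : 0 < Real.pi / p := div_pos Real.pi_pos (by exact_mod_cast (by omega : 0 < p))
  have h := tau_exp_re hp (θ := Real.pi / p) ⟨by linarith, le_rfl⟩
  rw [← halfRoot_eq, hL, re_ofReal_mul, halfRoot_eq, exp_ofReal_mul_I_re] at h
  rw [hL, circumradius, ← h, mul_div_cancel_right₀ _ (cos_pi_div_pos hp).ne']

theorem tau_halfRoot_pow_mem_vertices (hp : 2 < p) (k : ℕ) :
    tau p (halfRoot p ^ (2 * k + 1)) ∈ vertices p := by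
  refine ⟨k, ?_⟩
  have h : ((halfRoot p ^ 2) ^ k) ^ p = 1 := by
    rw [← pow_mul, mul_comm k, pow_mul, halfRoot_sq_pow (by omega), one_pow]
  rw [pow_succ, pow_mul, tau_mul_of_pow_eq_one h, tau_halfRoot hp]
  simp only [halfRoot]
  ring

theorem exists_eq_halfRoot_pow_mul_exp (hp : 2 < p) {w : ℂ} (hw : ‖w‖ = 1) :
    ∃ k : ℕ, ∃ θ ∈ Icc (-(Real.pi / p)) (Real.pi / p), w = (halfRoot p ^ 2) ^ k * exp (θ * I) := by
  have hp0 : (0 : ℝ) < p := by exact_mod_cast (by omega : 0 < p)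
  have hpi := Real.pi_pos
  -- The shift by `2π` makes the angle positive, so a natural number floor can round `φ / (2π / p)`
  -- to a nearest integer `k`.
  set φ : ℝ := w.arg + 2 * Real.pi with hφ
  have hφ0 : 0 < φ := by linarith [neg_pi_lt_arg w]
  have hwφ : w = exp (φ * I) := by
    have h := norm_mul_exp_arg_mul_I w
    rw [hw, ofReal_one, one_mul] at h
    rw [hφ]
    push_cast
    rw [add_mul, exp_add, h, exp_two_pi_mul_I, mul_one]
  set k := ⌊φ * p / (2 * Real.pi) + 1 / 2⌋₊ with hk
  have h0 : 0 ≤ φ * p / (2 * Real.pi) + 1 / 2 := by positivity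
  have h1 := Nat.floor_le h0
  have h2 := Nat.lt_floor_add_one (φ * p / (2 * Real.pi) + 1 / 2)
  rw [← hk] at h1 h2
  have h3 : φ = (φ * p / (2 * Real.pi)) * (2 * (Real.pi / p)) := by field_simp
  have hd : 0 < Real.pi / p := by positivity
  refine ⟨k, φ - k * (2 * (Real.pi / p)), ⟨?_, ?_⟩, ?_⟩
  · nlinarith
  · nlinarith
  · rw [hwφ, halfRoot_eq, ← exp_nat_mul, ← exp_nat_mul, ← exp_add]
    congr 1
    push_cast
    ring

/-- The boundary of the disc is mapped into the polygon and onto lines supporting it. -/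
theorem tau_mem_of_norm_eq_one (hp : 2 < p) {w : ℂ} (hw : ‖w‖ = 1) :
    tau p w ∈ convexHull ℝ (vertices p) ∧ ∃ a : ℂ, a ^ p = 1 ∧ (a * tau p w).re = inradius p := by
  obtain ⟨k, θ, hθ, rfl⟩ := exists_eq_halfRoot_pow_mul_exp hp hw
  have hpi : 0 < Real.pi / p := div_pos Real.pi_pos (by exact_mod_cast (by omega : 0 < p))
  have h : ((halfRoot p ^ 2) ^ k) ^ p = 1 := by
    rw [← pow_mul, mul_comm k, pow_mul, halfRoot_sq_pow (by omega), one_pow]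
  have hl : -(Real.pi / p) ∈ Icc (-(Real.pi / p)) (Real.pi / p) := ⟨le_rfl, by linarith⟩
  have hr : Real.pi / p ∈ Icc (-(Real.pi / p)) (Real.pi / p) := ⟨by linarith, le_rfl⟩
  rw [tau_mul_of_pow_eq_one h]
  constructor
  · obtain ⟨s, t, hs, ht, hst, hseg⟩ := mem_segment_of_re_eq
      ((tau_exp_re hp hl).trans (tau_exp_re hp hθ).symm)
      ((tau_exp_re hp hr).trans (tau_exp_re hp hθ).symm)
      (monotoneOn_tau_exp_im hp hl hθ hθ.1) (monotoneOn_tau_exp_im hp hθ hr hθ.2)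
    -- The lower end point needs a natural odd exponent: `β⁻¹ = β ^ (2p - 1)`.
    have hexp : exp ((-(Real.pi / p) : ℝ) * I) = halfRoot p ^ (2 * (p - 1) + 1) := by
      have h1 : halfRoot p ^ (2 * (p - 1) + 1) * halfRoot p = 1 := by
        rw [← pow_succ, ← halfRoot_sq_pow (show p ≠ 0 by omega), ← pow_mul]
        congr 1
        omega
      rw [eq_inv_of_mul_eq_one_left h1, halfRoot_eq, ← exp_neg]
      congr 1
      push_cast
      ring
    have hA : (halfRoot p ^ 2) ^ k * tau p (exp ((-(Real.pi / p) : ℝ) * I)) ∈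
        convexHull ℝ (vertices p) := by
      rw [← tau_mul_of_pow_eq_one h, hexp, ← pow_mul, ← pow_add,
        show 2 * k + (2 * (p - 1) + 1) = 2 * (k + (p - 1)) + 1 by ring]
      exact subset_convexHull ℝ _ (tau_halfRoot_pow_mem_vertices hp _)
    have hB : (halfRoot p ^ 2) ^ k * tau p (exp ((Real.pi / p : ℝ) * I)) ∈
        convexHull ℝ (vertices p) := by
      rw [← tau_mul_of_pow_eq_one h, ← halfRoot_eq, ← pow_mul, ← pow_succ]
      exact subset_convexHull ℝ _ (tau_halfRoot_pow_mem_vertices hp _)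
    have := convex_convexHull ℝ (vertices p) hA hB hs ht hst
    rw [← hseg]
    convert this using 1
    simp only [real_smul]
    ring
  · refine ⟨((halfRoot p ^ 2) ^ k)⁻¹, by rw [inv_pow, h, inv_one], ?_⟩
    have hne : (halfRoot p ^ 2) ^ k ≠ 0 := by simp [halfRoot, exp_ne_zero]
    rw [inv_mul_cancel_left₀ hne]
    exact tau_exp_re hp hθ

end Arc

/-! ### The image of the disc is the polygon -/

section Polygon

variable {p : ℕ}

theorem norm_eq_one_of_pow_eq_neg_one {p : ℕ} (hp : p ≠ 0) {u : ℂ} (hu : u ^ p = -1) :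
    ‖u‖ = 1 := by
  have h : ‖u‖ ^ p = 1 := by rw [← norm_pow, hu, norm_neg, norm_one]
  exact (pow_eq_one_iff_of_nonneg (norm_nonneg _) hp).1 h

/-- Since `cos (p |arg u|) = -1` and `cos > -1` on `[0, π)`, the angle `|arg u|` is at least `π /
p`. -/
theorem re_le_cos_pi_div (hp : 2 < p) {u : ℂ} (hu : u ^ p = -1) :
    u.re ≤ Real.cos (Real.pi / p) := by
  have hp0 : (0 : ℝ) < p := by exact_mod_cast (by omega : 0 < p)
  have hn := norm_eq_one_of_pow_eq_neg_one (by omega) hu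
  have hexp : u = exp (u.arg * I) := by
    have h := norm_mul_exp_arg_mul_I u
    rw [hn, ofReal_one, one_mul] at h
    exact h.symm
  have hre : u.re = Real.cos |u.arg| := by
    rw [Real.cos_abs]
    conv_lhs => rw [hexp, exp_ofReal_mul_I_re]
  have hcos : Real.cos (p * |u.arg|) = -1 := by
    have h1 : Real.cos (p * u.arg) = -1 := by
      have h2 := congrArg re hu
      rw [hexp, ← exp_nat_mul, ← mul_assoc, ← ofReal_natCast, ← ofReal_mul,
        exp_ofReal_mul_I_re] at h2
      simpa using h2
    rwa [← Real.cos_abs, abs_mul, abs_of_pos hp0] at h1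
  rw [hre]
  refine Real.cos_le_cos_of_nonneg_of_le_pi (by positivity) (abs_arg_le_pi u) ?_
  by_contra! hlt
  have h1 : p * |u.arg| < Real.pi := by
    have := (lt_div_iff₀ hp0).1 hlt
    linarith
  have h2 := Real.strictAntiOn_cos ⟨by positivity, h1.le⟩ ⟨Real.pi_pos.le, le_rfl⟩ h1
  rw [Real.cos_pi, hcos] at h2
  exact lt_irrefl _ h2

theorem re_mul_le_inradius (hp : 2 < p) {a : ℂ} (ha : a ^ p = 1) {z : ℂ}
    (hz : z ∈ convexHull ℝ (vertices p)) : (a * z).re ≤ inradius p := by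
  have hconv : Convex ℝ {z : ℂ | (a * z).re ≤ inradius p} :=
    convex_halfSpace_le (f := fun z : ℂ => (a * z).re)
      ⟨fun x y => by simp [mul_add], fun c x => by simp; ring⟩ _
  refine convexHull_min ?_ hconv hz
  rintro _ ⟨k, rfl⟩
  have hu : (a * halfRoot p ^ (2 * k + 1)) ^ p = -1 := by
    rw [mul_pow, ha, ← pow_mul, mul_comm _ p, pow_mul, halfRoot_pow (by omega), one_mul,
      Odd.neg_one_pow ⟨k, rfl⟩]
  have h := mul_le_mul_of_nonneg_left (re_le_cos_pi_div hp hu) (circumradius_pos hp).le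
  rw [circumradius, div_mul_cancel₀ _ (cos_pi_div_pos hp).ne', ← circumradius,
    ← re_ofReal_mul] at h
  show (a * (circumradius p * halfRoot p ^ (2 * k + 1))).re ≤ inradius p
  rwa [mul_left_comm]

/-- An interior point can be scaled by some `s > 1` within the hull; as `K_p > 0`, the weak
inequality at the scaled point is strict at the original one. -/
theorem re_mul_lt_inradius (hp : 2 < p) {a : ℂ} (ha : a ^ p = 1) {z : ℂ}
    (hz : z ∈ openPolygon p) : (a * z).re < inradius p := by
  have ht : Tendsto (fun s : ℝ => (s : ℂ) * z) (𝓝 1) (𝓝 z) := by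
    have : Continuous fun s : ℝ => (s : ℂ) * z := by fun_prop
    simpa using this.tendsto 1
  have hev := ht.eventually (mem_interior_iff_mem_nhds.1 hz)
  obtain ⟨s, hs, hs1⟩ :=
    ((hev.filter_mono nhdsWithin_le_nhds).and (self_mem_nhdsWithin (s := Ioi (1 : ℝ)))).exists
  have h := re_mul_le_inradius hp ha hs
  rw [mul_left_comm, re_ofReal_mul] at h
  have hK := inradius_pos hp
  have hs1 : 1 < s := hs1
  by_contra! hle
  nlinarith

theorem finite_vertices (hp : p ≠ 0) : (vertices p).Finite := by
  refine ((finite_Iio p).image fun k =>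
    (circumradius p : ℂ) * halfRoot p ^ (2 * k + 1)).subset ?_
  rintro _ ⟨k, rfl⟩
  refine ⟨k % p, Nat.mod_lt _ (Nat.pos_of_ne_zero hp), ?_⟩
  have h : (halfRoot p ^ 2) ^ (k % p) = (halfRoot p ^ 2) ^ k := by
    conv_rhs => rw [← Nat.mod_add_div k p, pow_add, pow_mul _ p, halfRoot_sq_pow hp, one_pow,
      mul_one]
  change (circumradius p : ℂ) * halfRoot p ^ (2 * (k % p) + 1) =
    circumradius p * halfRoot p ^ (2 * k + 1)
  rw [pow_succ _ (2 * (k % p)), pow_mul, h, pow_succ _ (2 * k), pow_mul]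

theorem isOpen_tau_image_ball (hp : 2 < p) : IsOpen (tau p '' ball 0 1) := by
  rw [isOpen_iff_mem_nhds]
  rintro _ ⟨w, hw, rfl⟩
  have hmem := fun v hv => one_add_pow_mem_slitPlane (p := p) (by omega) (w := v) hv
  have hd : DifferentiableOn ℂ (tau p) (ball 0 1) := fun v hv =>
    (hasDerivAt_tau (hmem v hv)).differentiableAt.differentiableWithinAt
  have hs := (hd.analyticAt (isOpen_ball.mem_nhds hw)).hasStrictDerivAt
  rw [(hasDerivAt_tau (hmem w hw)).deriv] at hs
  rw [← hs.map_nhds_eq (scIntegrand_ne_zero (hmem w hw))]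
  exact image_mem_map (isOpen_ball.mem_nhds hw)

theorem isCompact_tau_image (hp : 2 < p) : IsCompact (tau p '' closedBall 0 1) :=
  (isCompact_closedBall 0 1).image_of_continuousOn (continuousOn_tau hp)

/-- A compact set whose part outside a closed convex set `A` lies in its interior is contained
in `A`. -/
theorem _root_.Convex.subset_of_isCompact_of_diff_isOpen {E : Type*} [NormedAddCommGroup E]
    [NormedSpace ℝ E] {A C U : Set E} (hA : Convex ℝ A) (hA' : IsClosed A) (hne : A.Nonempty)
    (hC : IsCompact C) (hU : IsOpen U) (hUC : U ⊆ C) (hCU : C ⊆ A ∪ U) : C ⊆ A := by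
  intro z hz
  by_contra hzA
  obtain ⟨f, u, hfA, hfz⟩ := geometric_hahn_banach_closed_point hA hA' hzA
  -- The maximum of `f` on `C` exceeds its values on `A`, so it is attained in `U`; there a small
  -- step away from `y ∈ A` increases `f` further.
  obtain ⟨m, hm, hmax⟩ := hC.exists_isMaxOn ⟨z, hz⟩ f.continuous.continuousOn
  obtain ⟨y, hy⟩ := hne
  have hfm : u < f m := hfz.trans_le (hmax hz)
  have hmU : m ∈ U := (hCU hm).resolve_left fun h => (hfA m h).not_gt hfm
  have ht : Tendsto (fun s : ℝ => m + s • (m - y)) (𝓝 0) (𝓝 m) := by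
    have : Continuous fun s : ℝ => m + s • (m - y) := by fun_prop
    simpa using this.tendsto 0
  have hev := ht.eventually (hU.mem_nhds hmU)
  obtain ⟨s, hs, hs0⟩ :=
    ((hev.filter_mono nhdsWithin_le_nhds).and (self_mem_nhdsWithin (s := Ioi (0 : ℝ)))).exists
  have h1 : f (m + s • (m - y)) ≤ f m := hmax (hUC hs)
  have h2 := mul_pos hs0 (sub_pos.2 ((hfA y hy).trans hfm))
  rw [map_add, map_smul, map_sub, smul_eq_mul] at h1
  linarith

theorem tau_image_closedBall_subset (hp : 2 < p) :
    tau p '' closedBall 0 1 ⊆ convexHull ℝ (vertices p) := by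
  refine (convex_convexHull ℝ _).subset_of_isCompact_of_diff_isOpen
    ((finite_vertices (by omega)).isCompact_convexHull ℝ).isClosed
    ⟨_, subset_convexHull ℝ _ (tau_halfRoot_pow_mem_vertices hp 0)⟩ (isCompact_tau_image hp)
    (isOpen_tau_image_ball hp) (image_mono ball_subset_closedBall) ?_
  rintro _ ⟨w, hw, rfl⟩
  rcases (mem_closedBall_zero_iff.1 hw).lt_or_eq with h | h
  · exact Or.inr ⟨w, by simpa using h, rfl⟩
  · exact Or.inl (tau_mem_of_norm_eq_one hp h).1

/-- The image of the circle lies on the lines `re (a z) = K_p`, which `C` avoids. So `C` is covered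
by the disjoint open sets `τ (ball)` and the complement of `τ (closedBall)`, and `0` selects the
first. -/
theorem subset_tau_image_ball (hp : 2 < p) {C : Set ℂ} (hC : IsPreconnected C) (h0 : 0 ∈ C)
    (hlt : ∀ z ∈ C, ∀ a : ℂ, a ^ p = 1 → (a * z).re < inradius p) : C ⊆ tau p '' ball 0 1 := by
  refine hC.subset_left_of_subset_union (isOpen_tau_image_ball hp)
    (isCompact_tau_image hp).isClosed.isOpen_compl
    (disjoint_compl_right.mono_left (image_mono ball_subset_closedBall)) ?_
    ⟨0, h0, 0, by simp, tau_zero p⟩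
  intro z hz
  by_cases hzC : z ∈ tau p '' closedBall 0 1
  · obtain ⟨w, hw, rfl⟩ := hzC
    rcases (mem_closedBall_zero_iff.1 hw).lt_or_eq with h | h
    · exact Or.inl ⟨w, by simpa using h, rfl⟩
    · obtain ⟨a, ha, hK⟩ := (tau_mem_of_norm_eq_one hp h).2
      exact absurd hK (hlt _ hz a ha).ne
  · exact Or.inr hzC

theorem tau_image_ball (hp : 2 < p) : tau p '' ball 0 1 = openPolygon p := by
  have hsub : tau p '' ball 0 1 ⊆ openPolygon p :=
    interior_maximal ((image_mono ball_subset_closedBall).trans (tau_image_closedBall_subset hp))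
      (isOpen_tau_image_ball hp)
  refine hsub.antisymm (subset_tau_image_ball hp ?_ (hsub ⟨0, by simp, tau_zero p⟩)
    fun z hz a ha => re_mul_lt_inradius hp ha hz)
  exact (convex_convexHull ℝ _).interior.isPreconnected

theorem tau_image_closedBall (hp : 2 < p) :
    tau p '' closedBall 0 1 = closure (openPolygon p) := by
  rw [← tau_image_ball hp]
  refine subset_antisymm ?_ (closure_minimal (image_mono ball_subset_closedBall)
    (isCompact_tau_image hp).isClosed)
  have h := closure_ball (0 : ℂ) one_ne_zero
  have h1 : ContinuousOn (tau p) (closure (ball 0 1)) := h ▸ continuousOn_tau hp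
  have := h1.image_closure
  rwa [h] at this

theorem ball_solutionRadius_subset (hp : 2 < p) :
    ball 0 (solutionRadius p) ⊆ openPolygon p := by
  rw [← tau_image_ball hp]
  refine subset_tau_image_ball hp (convex_ball _ _).isPreconnected
    (by simpa using solutionRadius_pos hp) fun z hz a ha => ?_
  have hn : ‖a‖ = 1 := by
    refine (pow_eq_one_iff_of_nonneg (norm_nonneg _) (show p ≠ 0 by omega)).1 ?_
    rw [← norm_pow, ha, norm_one]
  have h := re_le_norm (a * z)
  rw [norm_mul, hn, one_mul] at h
  have hz' : ‖z‖ < solutionRadius p := by simpa using hz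
  linarith [solutionRadius_le_one_half hp, one_half_le_inradius hp]

end Polygon

/-! ### Uniqueness for the initial value problem -/

variable {p : ℕ}

/-- On each ray from `0` the system is a real autonomous equation with polynomial field, hence
Lipschitz on the compact union of the two trajectories. -/
theorem IsSolutionPair.eqOn {U : Set ℂ} (hU : StarConvex ℝ 0 U) {s c s₀ c₀ : ℂ → ℂ}
    (h : IsSolutionPair p U s c) (h₀ : IsSolutionPair p U s₀ c₀) :
    EqOn s s₀ U ∧ EqOn c c₀ U := by
  suffices ∀ z ∈ U, (s z, c z) = (s₀ z, c₀ z) from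
    ⟨fun z hz => congrArg Prod.fst (this z hz), fun z hz => congrArg Prod.snd (this z hz)⟩
  intro z hz
  let v : ℂ × ℂ → ℂ × ℂ := fun u => (u.2 ^ (p - 1) * z, -(u.1 ^ (p - 1)) * z)
  have hv : ContDiff ℝ 1 v := by fun_prop
  have hmem : ∀ x ∈ Icc (0 : ℝ) 1, (x : ℂ) * z ∈ U := by
    intro x hx
    have := hU hz (sub_nonneg.2 hx.2) hx.1 (by ring)
    simpa using this
  have hray : ∀ {s c : ℂ → ℂ}, IsSolutionPair p U s c → ∀ x ∈ Icc (0 : ℝ) 1,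
      HasDerivAt (fun x : ℝ => (s (x * z), c (x * z))) (v (s (x * z), c (x * z))) x := by
    intro s c h x hx
    have h1 : HasDerivAt (fun y : ℂ => y * z) z (x : ℂ) := by
      simpa using (hasDerivAt_id (x : ℂ)).mul_const z
    exact ((HasDerivAt.comp (x : ℂ) (h.deriv_s _ (hmem x hx)) h1).comp_ofReal).prodMk
      ((HasDerivAt.comp (x : ℂ) (h.deriv_c _ (hmem x hx)) h1).comp_ofReal)
  have hcont : ∀ {s c : ℂ → ℂ}, IsSolutionPair p U s c →
      ContinuousOn (fun x : ℝ => (s (x * z), c (x * z))) (Icc 0 1) := fun h x hx =>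
    (hray h x hx).continuousAt.continuousWithinAt
  obtain ⟨K, hK⟩ := hv.locallyLipschitz.locallyLipschitzOn.exists_lipschitzOnWith_of_compact
    ((isCompact_Icc.image_of_continuousOn (hcont h)).union
      (isCompact_Icc.image_of_continuousOn (hcont h₀)))
  have := ODE_solution_unique_of_mem_Icc_right (v := fun _ => v) (fun _ _ => hK) (hcont h)
    (fun x hx => (hray h x ⟨hx.1, hx.2.le⟩).hasDerivWithinAt)
    (fun x hx => Or.inl ⟨x, ⟨hx.1, hx.2.le⟩, rfl⟩) (hcont h₀)
    (fun x hx => (hray h₀ x ⟨hx.1, hx.2.le⟩).hasDerivWithinAt)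
    (fun x hx => Or.inr ⟨x, ⟨hx.1, hx.2.le⟩, rfl⟩)
    (by simp [h.s_zero, h.c_zero, h₀.s_zero, h₀.c_zero]) (right_mem_Icc.2 zero_le_one)
  simpa using this

/-! ### The inverse map, its boundary homeomorphism and its derivative -/

/-- The inverse of the Schwarz-Christoffel map. -/
noncomputable def tauInv (p : ℕ) : ℂ → ℂ := Function.invFunOn (tau p) (closedBall 0 1)

theorem bijOn_tau (hp : 2 < p) : BijOn (tau p) (closedBall 0 1) (closure (openPolygon p)) :=
  tau_image_closedBall hp ▸ (injOn_tau hp).bijOn_image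

theorem invOn_tauInv (hp : 2 < p) :
    InvOn (tau p) (tauInv p) (closure (openPolygon p)) (closedBall 0 1) :=
  (bijOn_tau hp).invOn_invFunOn.symm

theorem tauInv_tau (hp : 2 < p) {w : ℂ} (hw : w ∈ closedBall (0 : ℂ) 1) :
    tauInv p (tau p w) = w :=
  (invOn_tauInv hp).2 hw

theorem tau_tauInv (hp : 2 < p) {z : ℂ} (hz : z ∈ openPolygon p) : tau p (tauInv p z) = z :=
  (invOn_tauInv hp).1 (subset_closure hz)

theorem tauInv_zero (hp : 2 < p) : tauInv p 0 = 0 := by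
  simpa [tau_zero] using tauInv_tau hp (w := 0) (by simp)

theorem bijOn_tauInv (hp : 2 < p) : BijOn (tauInv p) (openPolygon p) (ball 0 1) := by
  rw [← tau_image_ball hp]
  refine BijOn.symm ⟨?_, fun w hw => tauInv_tau hp (ball_subset_closedBall hw)⟩
    ((injOn_tau hp).mono ball_subset_closedBall).bijOn_image
  rintro _ ⟨w, hw, rfl⟩
  rw [tauInv_tau hp (ball_subset_closedBall hw)]

theorem restrictsToHomeomorph_tauInv (hp : 2 < p) :
    RestrictsToHomeomorph (tauInv p) (closure (openPolygon p)) (closedBall 0 1) := by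
  have hcpt : CompactSpace (closedBall (0 : ℂ) 1) :=
    isCompact_iff_compactSpace.1 (isCompact_closedBall 0 1)
  let e : closedBall (0 : ℂ) 1 ≃ closure (openPolygon p) := (bijOn_tau hp).equiv
  have he : ∀ w, (e w : ℂ) = tau p w := fun _ => rfl
  have hc : Continuous e := by
    refine Continuous.subtype_mk ?_ _
    exact continuousOn_iff_continuous_domRestrict.1 (continuousOn_tau hp)
  refine ⟨(Continuous.homeoOfEquivCompactToT2 hc).symm, fun z => ?_⟩
  obtain ⟨w, rfl⟩ := e.surjective z
  rw [he, tauInv_tau hp w.2]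
  exact congrArg Subtype.val (e.symm_apply_apply w)

theorem RestrictsToHomeomorph.continuousOn {f : ℂ → ℂ} {A B : Set ℂ}
    (h : RestrictsToHomeomorph f A B) : ContinuousOn f A := by
  obtain ⟨e, he⟩ := h
  rw [continuousOn_iff_continuous_domRestrict]
  exact (continuous_subtype_val.comp e.continuous).congr he

theorem one_add_tauInv_pow_mem_slitPlane (hp : 2 < p) {z : ℂ} (hz : z ∈ openPolygon p) :
    1 + tauInv p z ^ p ∈ slitPlane :=
  one_add_pow_mem_slitPlane (by omega) ((bijOn_tauInv hp).mapsTo hz)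

theorem hasDerivAt_tauInv (hp : 2 < p) {z : ℂ} (hz : z ∈ openPolygon p) :
    HasDerivAt (tauInv p) (scIntegrand p (tauInv p z))⁻¹ z := by
  have hmem := one_add_tauInv_pow_mem_slitPlane hp hz
  have hnhds : openPolygon p ∈ 𝓝 z := isOpen_interior.mem_nhds hz
  refine HasDerivAt.of_local_left_inverse ?_ (hasDerivAt_tau hmem) (scIntegrand_ne_zero hmem) ?_
  · exact (restrictsToHomeomorph_tauInv hp).continuousOn.continuousAt
      (mem_of_superset hnhds subset_closure)
  · filter_upwards [hnhds] with y hy using tau_tauInv hp hy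

theorem isConformalBijection_tauInv (hp : 2 < p) :
    IsConformalBijection (tauInv p) (openPolygon p) (ball 0 1) where
  holomorphic z hz := (hasDerivAt_tauInv hp hz).differentiableAt.differentiableWithinAt
  deriv_ne_zero z hz := by
    rw [(hasDerivAt_tauInv hp hz).deriv]
    exact inv_ne_zero (scIntegrand_ne_zero (one_add_tauInv_pow_mem_slitPlane hp hz))
  bijOn := bijOn_tauInv hp

/-! ### The solution pair on the whole polygon -/

/-- The cosine recovered from the tangent `tauInv` by `c ^ p (1 + t ^ p) = 1`. -/
noncomputable def cosOfTan (p : ℕ) (z : ℂ) : ℂ := (1 + tauInv p z ^ p) ^ (-(1 / p : ℂ))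

theorem cosOfTan_ne_zero (hp : 2 < p) {z : ℂ} (hz : z ∈ openPolygon p) : cosOfTan p z ≠ 0 := by
  simp [cosOfTan, cpow_eq_zero_iff,
    slitPlane_ne_zero (one_add_tauInv_pow_mem_slitPlane hp hz)]

/-- With `t' = (1 + t ^ p) ^ (2 / p)`, the chain rule gives `c' = -t ^ (p - 1) (1 + t ^ p) ^ (1 / p
- 1) = -(t c) ^ (p - 1)`. Then `t' c = c ^ (p - 1) (1 + t ^ p)`, and adding `t c'` leaves `c ^ (p -
1)`. -/
theorem isSolutionPair_tauInv (hp : 2 < p) :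
    IsSolutionPair p (openPolygon p) (fun z => tauInv p z * cosOfTan p z) (cosOfTan p) := by
  have hp0 : (p : ℂ) ≠ 0 := by
    have : p ≠ 0 := by omega
    exact_mod_cast this
  have hcast : ((p - 1 : ℕ) : ℂ) = p - 1 := by
    rw [Nat.cast_sub (by omega), Nat.cast_one]
  have hpow : ∀ z ∈ openPolygon p,
      cosOfTan p z ^ (p - 1) = (1 + tauInv p z ^ p) ^ (1 / p - 1 : ℂ) := by
    intro z hz
    rw [cosOfTan, ← cpow_nat_mul, hcast]
    congr 1
    field_simp
    ring
  have hc : ∀ z ∈ openPolygon p,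
      HasDerivAt (cosOfTan p) (-((tauInv p z * cosOfTan p z) ^ (p - 1))) z := by
    intro z hz
    have hA := one_add_tauInv_pow_mem_slitPlane hp hz
    have h1 := ((((hasDerivAt_tauInv hp hz).pow p).const_add 1).cpow_const
      (c := -(1 / p : ℂ)) hA)
    refine h1.congr_deriv ?_
    rw [mul_pow, hpow z hz, scIntegrand, one_div (_ ^ (2 / p : ℂ)), inv_inv, Pi.pow_apply,
      show (1 / p - 1 : ℂ) = (-(1 / p) - 1) + 2 / p by field_simp; ring,
      cpow_add _ _ (slitPlane_ne_zero hA)]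
    field_simp
  refine ⟨fun z hz => ?_, hc, by simp [tauInv_zero hp], ?_⟩
  · have hA := one_add_tauInv_pow_mem_slitPlane hp hz
    have hA0 := slitPlane_ne_zero hA
    refine ((hasDerivAt_tauInv hp hz).mul (hc z hz)).congr_deriv ?_
    have h1 : (scIntegrand p (tauInv p z))⁻¹ * cosOfTan p z =
        cosOfTan p z ^ (p - 1) * (1 + tauInv p z ^ p) := by
      have h2 : (1 + tauInv p z ^ p) ^ (1 / p - 1 : ℂ) * (1 + tauInv p z ^ p) =
          (1 + tauInv p z ^ p) ^ (1 / p - 1 + 1 : ℂ) := by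
        rw [cpow_add _ _ hA0, cpow_one]
      rw [hpow z hz, h2, scIntegrand, cosOfTan, one_div, inv_inv, ← cpow_add _ _ hA0]
      congr 1
      ring
    rw [h1, mul_pow]
    have h2 : tauInv p z ^ p = tauInv p z * tauInv p z ^ (p - 1) := by
      rw [← pow_succ']
      congr 1
      omega
    rw [h2]
    ring
  · simp [cosOfTan, tauInv_zero hp, show p ≠ 0 by omega]

end HigherTrig

/-! ### Assembly -/

theorem theorem13 (p : ℕ) (hp : 2 < p) :
    (∃ s c : ℂ → ℂ,
      HigherTrig.IsSolutionPair p (Metric.ball 0 (HigherTrig.solutionRadius p)) s c) ∧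
    ∀ s c : ℂ → ℂ,
      HigherTrig.IsSolutionPair p (Metric.ball 0 (HigherTrig.solutionRadius p)) s c →
      Metric.ball 0 (HigherTrig.solutionRadius p) ⊆ HigherTrig.openPolygon p ∧
      (∀ z ∈ Metric.ball (0 : ℂ) (HigherTrig.solutionRadius p), c z ≠ 0) ∧
      ∃ t : ℂ → ℂ,
        (∀ z ∈ Metric.ball (0 : ℂ) (HigherTrig.solutionRadius p), t z = s z / c z) ∧
        HigherTrig.IsConformalBijection t (HigherTrig.openPolygon p) (Metric.ball 0 1) ∧
        HigherTrig.RestrictsToHomeomorph t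
          (closure (HigherTrig.openPolygon p)) (Metric.closedBall 0 1) ∧
        Set.InvOn (HigherTrig.tau p) t
          (closure (HigherTrig.openPolygon p)) (Metric.closedBall 0 1) := by
  have hsub := HigherTrig.ball_solutionRadius_subset hp
  have hP := HigherTrig.isSolutionPair_tauInv hp
  have h₀ : HigherTrig.IsSolutionPair p (ball 0 (HigherTrig.solutionRadius p))
      (fun z => HigherTrig.tauInv p z * HigherTrig.cosOfTan p z) (HigherTrig.cosOfTan p) :=
    ⟨fun z hz => hP.deriv_s z (hsub hz), fun z hz => hP.deriv_c z (hsub hz), hP.s_zero, hP.c_zero⟩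
  refine ⟨⟨_, _, h₀⟩, fun s c h => ?_⟩
  obtain ⟨hs, hc⟩ := h.eqOn ((convex_ball _ _).starConvex
    (mem_ball_self (HigherTrig.solutionRadius_pos hp))) h₀
  refine ⟨hsub, fun z hz => ?_, HigherTrig.tauInv p, fun z hz => ?_,
    HigherTrig.isConformalBijection_tauInv hp, HigherTrig.restrictsToHomeomorph_tauInv hp,
    HigherTrig.invOn_tauInv hp⟩
  · rw [hc hz]
    exact HigherTrig.cosOfTan_ne_zero hp (hsub hz)
  · rw [hs hz, hc hz, mul_div_cancel_right₀ _ (HigherTrig.cosOfTan_ne_zero hp (hsub hz))]
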